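/- For Banach spaces $X,Y$ over $\mathbb{R}$, a linear isometry (not necessarily onto) $T\colon X\to Y$ is called a U-embedding if for every $x^*\in X^*$ with $\|x^*\|=1$ there is exactly one $y^*\in Y^*$ such that $y^*\circ T=x^*$ and $\|y^*\|=\|x^*\|$; and $X$ can be U-embedded into $Y$ if there is a U-embedding $T\colon X\to Y$. A point $p$ of a topological space $K$ is a $G_\delta$-point if $\{p\}$ is a $G_\delta$-set, i.e. a countable intersection of open subsets of $K$. Proposition. Let $N$ be a natural number, let $K$ be a compact Hausdorff space, and let $C(K)$ be the space of continuous real-valued functions on $K$ with the maximum norm. Then $\ell_\infty^N$ (that is, $\mathbb{R}^N$ with the maximum norm) can be U-embedded into $C(K)$ if and only if $K$ contains at least $N$ distinct $G_\delta$-points. -/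

import Mathlib

/-- `y'` is a Hahn--Banach extension of `x'` through the linear isometry `T : X → Y`:
`T^* y' = x'` and `‖y'‖ = ‖x'‖`. -/
def IsHahnBanachExtension {X Y : Type*} [NormedAddCommGroup X] [NormedSpace ℝ X]
    [NormedAddCommGroup Y] [NormedSpace ℝ Y] (T : X →ₗᵢ[ℝ] Y)
    (x' : StrongDual ℝ X) (y' : StrongDual ℝ Y) : Prop :=
  y'.comp T.toContinuousLinearMap = x' ∧ ‖y'‖ = ‖x'‖

/-- A linear isometry (into) `T : X → Y` is a U-embedding if every functional of norm one on `X`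
has a unique Hahn--Banach extension through `T`. -/
def IsUEmbedding {X Y : Type*} [NormedAddCommGroup X] [NormedSpace ℝ X]
    [NormedAddCommGroup Y] [NormedSpace ℝ Y] (T : X →ₗᵢ[ℝ] Y) : Prop :=
  ∀ x' : StrongDual ℝ X, ‖x'‖ = 1 → ∃! y' : StrongDual ℝ Y, IsHahnBanachExtension T x' y'

/-- `X` can be U-embedded into `Y`. -/
def UEmbeddable (X Y : Type*) [NormedAddCommGroup X] [NormedSpace ℝ X]
    [NormedAddCommGroup Y] [NormedSpace ℝ Y] : Prop :=
  ∃ T : X →ₗᵢ[ℝ] Y, IsUEmbedding T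

/-- The set of `G_δ`-points of a topological space. -/
def gDeltaPoints (K : Type*) [TopologicalSpace K] : Set K :=
  {p | IsGδ ({p} : Set K)}

/-! If the `p i` are `G_δ`-points, disjointly supported functions peaking exactly there span an
isometric copy of `ℓ_∞^N`, and restriction to the `p i` is a norm-one left inverse, so composing
with it gives an extension. It is the only one: a norming vector is sent to a function of modulus
one only at some of the `p i`, and `apply_eq_zero_of_vanishes_on_peak` makes any extension depend
only on the values there.

Conversely, by `sum_abs_apply_single_le_one`, at a point where `|T e_i| = 1` all other `T e_j`
vanish, so signed evaluation there extends the `i`-th coordinate functional. Uniqueness leaves one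
such point for each `i`, and it is a level set of a continuous function, hence `G_δ`. -/

/-- If `y'` has norm at most one and attains the value one at `f` in the unit ball of `C(K, ℝ)`,
then `y'` annihilates every function vanishing on the peak set of `|f|`. -/
lemma apply_eq_zero_of_vanishes_on_peak {K : Type*} [TopologicalSpace K] [CompactSpace K]
    (y' : StrongDual ℝ C(K, ℝ)) (hy : ‖y'‖ ≤ 1) (f : C(K, ℝ)) (hf : ∀ x, |f x| ≤ 1)
    (hyf : y' f = 1) (g : C(K, ℝ)) (hg : ∀ x, |f x| = 1 → g x = 0) : y' g = 0 := by
  have le_norm (h : C(K, ℝ)) : |y' h| ≤ ‖h‖ :=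
    (y'.le_of_opNorm_le hy h).trans_eq (one_mul _)
  refine abs_nonpos_iff.1 (le_of_forall_pos_le_add fun ε hε => ?_)
  rw [zero_add]
  -- Truncating `g` at `±ε` costs at most `ε`; the remainder `g - c` lives where `ε ≤ |g|`, a
  -- compact set on which `|f|` stays away from one.
  let c : C(K, ℝ) := ⟨fun x => max (-ε) (min ε (g x)), by fun_prop⟩
  have hcn : ‖c‖ ≤ ε := by
    refine (ContinuousMap.norm_le _ hε.le).2 fun x => ?_
    rw [Real.norm_eq_abs, abs_le]
    exact ⟨le_max_left _ _, max_le (by linarith) (min_le_left _ _)⟩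
  have hcg (x : K) (hx : |g x| < ε) : (g - c) x = 0 := by
    obtain ⟨h1, h2⟩ := abs_lt.1 hx
    change g x - max (-ε) (min ε (g x)) = 0
    rw [min_eq_right h2.le, max_eq_right h1.le, sub_self]
  have hC : IsCompact {x | ε ≤ |g x|} :=
    (isClosed_le continuous_const (by fun_prop)).isCompact
  obtain ⟨δ, hδ, hδC⟩ := hC.exists_forall_le' (f := fun x => 1 - |f x|) (a := 0)
    (by fun_prop) (fun x hx => by
      refine sub_pos.2 (lt_of_le_of_ne (hf x) fun h => ?_)
      have : ε ≤ |g x| := hx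
      rw [hg x h, abs_zero] at this
      linarith)
  obtain ⟨t, ht, htδ⟩ : ∃ t : ℝ, 0 < t ∧ t * ‖g - c‖ ≤ δ :=
    ⟨δ / (‖g - c‖ + 1), by positivity, by
      rw [div_mul_eq_mul_div, div_le_iff₀ (by positivity)]
      nlinarith [norm_nonneg (g - c)]⟩
  -- Both `f ± t • (g - c)` stay in the unit ball, where `y'` is already maximal at `f`, so `y' (g -
  -- c)` has neither sign.
  have key (u : ℝ) (hu : |u| = t) : u * y' (g - c) ≤ 0 := by
    have h1 : ‖f + u • (g - c)‖ ≤ 1 := by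
      refine (ContinuousMap.norm_le _ zero_le_one).2 fun x => ?_
      rw [ContinuousMap.add_apply, ContinuousMap.smul_apply, Real.norm_eq_abs, smul_eq_mul]
      rcases lt_or_ge |g x| ε with hx | hx
      · rw [hcg x hx, mul_zero, add_zero]
        exact hf x
      · refine (abs_add_le _ _).trans ?_
        rw [abs_mul, hu]
        have h2 := hδC x hx
        have h3 := mul_le_mul_of_nonneg_left ((g - c).norm_coe_le_norm x) ht.le
        rw [Real.norm_eq_abs] at h3
        linarith
    have h2 := (le_abs_self _).trans ((le_norm _).trans h1)
    rw [map_add, map_smul, hyf, smul_eq_mul] at h2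
    linarith
  have h0 : y' (g - c) = 0 := by
    have h1 := key t (abs_of_pos ht)
    have h2 := key (-t) (by rw [abs_neg, abs_of_pos ht])
    have h3 : t * y' (g - c) = 0 := by linarith
    exact (mul_eq_zero.1 h3).resolve_left ht.ne'
  have h1 : y' g = y' c := by rw [map_sub] at h0; linarith
  rw [h1]
  exact (le_norm c).trans hcn

/-- A norm-one functional on a finite-dimensional space attains its norm. -/
lemma exists_norm_le_one_apply_eq_one {X : Type*} [NormedAddCommGroup X] [NormedSpace ℝ X]
    [FiniteDimensional ℝ X] (x' : StrongDual ℝ X) (hx : ‖x'‖ = 1) :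
    ∃ s : X, ‖s‖ ≤ 1 ∧ x' s = 1 := by
  have := FiniteDimensional.proper ℝ X
  obtain ⟨s, hs, hss⟩ := (isCompact_closedBall (0 : X) 1).exists_sSup_image_eq
    ⟨0, by simp⟩ (f := fun x => ‖x' x‖) (by fun_prop)
  rw [x'.sSup_unitClosedBall_eq_norm, hx, Real.norm_eq_abs] at hss
  rw [mem_closedBall_zero_iff] at hs
  rcases (abs_eq zero_le_one).1 hss.symm with h | h
  · exact ⟨s, hs, h⟩
  · exact ⟨-s, by rwa [norm_neg], by rw [map_neg, h, neg_neg]⟩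

/-- Distinct `G_δ`-points of a compact Hausdorff space carry disjointly supported functions with
values in `[0, 1]`, each peaking exactly at its point. -/
lemma exists_disjoint_peak_functions {ι K : Type*} [Finite ι] [TopologicalSpace K]
    [CompactSpace K] [T2Space K] (p : ι → K) (hp : Function.Injective p)
    (hG : ∀ i, IsGδ ({p i} : Set K)) :
    ∃ f : ι → C(K, ℝ), (∀ i x, 0 ≤ f i x ∧ f i x ≤ 1) ∧ (∀ i x, f i x = 1 ↔ x = p i) ∧
      ∀ x i j, f i x ≠ 0 → f j x ≠ 0 → i = j := by
  obtain ⟨U, hU, hd⟩ := (Set.finite_range p).t2_separation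
  -- The `G_δ` hypothesis is what upgrades Urysohn's lemma to the value one at `p i` only.
  have (i : ι) := exists_continuous_one_zero_of_isCompact_of_isGδ (isCompact_singleton (x := p i))
    (hG i) (hU (p i)).2.isClosed_compl
    (Set.disjoint_singleton_left.2 fun h => h (hU (p i)).1)
  choose f hf1 hf0 _ hf using this
  refine ⟨f, hf, fun i x => ?_, fun x i j hi hj => ?_⟩
  · have := Set.ext_iff.1 (hf1 i) x
    simpa using this.symm
  · have hi' : x ∈ U (p i) := by_contra fun h => hi (hf0 i h)
    have hj' : x ∈ U (p j) := by_contra fun h => hj (hf0 j h)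
    by_contra hij
    exact Set.disjoint_left.1 (hd ⟨i, rfl⟩ ⟨j, rfl⟩ (hp.ne hij)) hi' hj'

lemma norm_restriction_le {ι K : Type*} [Fintype ι] [TopologicalSpace K] [CompactSpace K]
    (p : ι → K) (g : C(K, ℝ)) : ‖fun i => g (p i)‖ ≤ ‖g‖ :=
  (pi_norm_le_iff_of_nonneg (norm_nonneg _)).2 fun i => g.norm_coe_le_norm (p i)

/-- Restriction of continuous functions to finitely many points. -/
noncomputable def restrictToPoints {ι K : Type*} [Fintype ι] [TopologicalSpace K] [CompactSpace K]
    (p : ι → K) : C(K, ℝ) →L[ℝ] (ι → ℝ) :=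
  LinearMap.mkContinuous
    { toFun := fun g i => g (p i)
      map_add' := fun _ _ => rfl
      map_smul' := fun _ _ => rfl } 1
    fun g => (norm_restriction_le p g).trans_eq (one_mul _).symm

lemma norm_restrictToPoints_le {ι K : Type*} [Fintype ι] [TopologicalSpace K] [CompactSpace K]
    (p : ι → K) : ‖restrictToPoints p‖ ≤ 1 :=
  LinearMap.mkContinuous_norm_le _ zero_le_one _

lemma uEmbeddable_of_gDeltaPoints {ι K : Type*} [Fintype ι] [TopologicalSpace K]
    [CompactSpace K] [T2Space K] (p : ι → K) (hp : Function.Injective p)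
    (hG : ∀ i, IsGδ ({p i} : Set K)) : UEmbeddable (ι → ℝ) C(K, ℝ) := by
  classical
  obtain ⟨f, hf, hf1, hfd⟩ := exists_disjoint_peak_functions p hp hG
  have hfp (i j : ι) : f i (p j) = if i = j then 1 else 0 := by
    split_ifs with h
    · rw [(hf1 i _).2 (by rw [h])]
    · by_contra h0
      exact h (hfd (p j) i j h0 (by rw [(hf1 j _).2 rfl]; exact one_ne_zero))
  have sum_eq (x : K) (a : ι → ℝ) :
      (∑ i, a i * f i x = 0) ∨ ∃ i, ∑ i, a i * f i x = a i * f i x := by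
    by_cases h : ∃ i, f i x ≠ 0
    · obtain ⟨i, hi⟩ := h
      refine Or.inr ⟨i, Finset.sum_eq_single i (fun j _ hj => ?_) (by simp)⟩
      rw [by_contra fun h => hj (hfd x j i h hi), mul_zero]
    · push Not at h
      simp [h]
  let L : (ι → ℝ) →ₗ[ℝ] C(K, ℝ) :=
    { toFun := fun a => ∑ i, a i • f i
      map_add' := fun a b => by simp [add_smul, Finset.sum_add_distrib]
      map_smul' := fun c a => by simp [Finset.smul_sum, mul_smul] }
  have L_apply (a : ι → ℝ) (x : K) : L a x = ∑ i, a i * f i x := by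
    simp [L, ContinuousMap.sum_apply]
  have L_p (a : ι → ℝ) : (fun i => L a (p i)) = a := by
    ext j
    simp [L_apply, hfp]
  have L_le (a : ι → ℝ) (x : K) : |L a x| = 0 ∨ ∃ i, |L a x| ≤ ‖a‖ * f i x := by
    rw [L_apply]
    rcases sum_eq x a with h | ⟨i, h⟩
    · exact Or.inl (by rw [h, abs_zero])
    · refine Or.inr ⟨i, ?_⟩
      rw [h, abs_mul, abs_of_nonneg (hf i x).1]
      exact mul_le_mul_of_nonneg_right (norm_le_pi_norm a i) (hf i x).1
  have L_norm_le (a : ι → ℝ) (x : K) : |L a x| ≤ ‖a‖ := by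
    rcases L_le a x with h | ⟨i, h⟩
    · exact h.le.trans (norm_nonneg a)
    · exact h.trans (mul_le_of_le_one_right (norm_nonneg a) (hf i x).2)
  let T : (ι → ℝ) →ₗᵢ[ℝ] C(K, ℝ) :=
    { L with
      norm_map' := fun a => le_antisymm
        ((ContinuousMap.norm_le _ (norm_nonneg a)).2 (L_norm_le a))
        (by simpa only [L_p] using norm_restriction_le p (L a)) }
  have RT (a : ι → ℝ) : restrictToPoints p (T a) = a := L_p a
  refine ⟨T, fun x' hx' => ⟨x'.comp (restrictToPoints p), ⟨?_, le_antisymm ?_ ?_⟩, ?_⟩⟩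
  · ext1 a
    exact congrArg x' (RT a)
  · refine (x'.opNorm_comp_le _).trans ?_
    exact mul_le_of_le_one_right (norm_nonneg _) (norm_restrictToPoints_le p)
  · refine x'.opNorm_le_bound (norm_nonneg _) fun a => ?_
    have := (x'.comp (restrictToPoints p)).le_opNorm (T a)
    rwa [ContinuousLinearMap.comp_apply, RT, T.norm_map] at this
  · rintro y' ⟨hy, hyn⟩
    have hyT (a : ι → ℝ) : y' (T a) = x' a := DFunLike.congr_fun hy a
    obtain ⟨s, hs, hxs⟩ := exists_norm_le_one_apply_eq_one x' hx'
    ext1 g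
    have h0 := apply_eq_zero_of_vanishes_on_peak y' (hyn.trans hx').le (T s)
      (fun x => (L_norm_le s x).trans hs) ((hyT s).trans hxs)
      (g - T (restrictToPoints p g)) (fun x hx => by
        rcases L_le s x with h | ⟨i, h⟩
        · exact absurd (h.symm.trans hx) zero_ne_one
        · have h1 : 1 ≤ f i x := by
            refine hx.symm.le.trans (h.trans ?_)
            exact mul_le_of_le_one_left (hf i x).1 hs
          rw [(hf1 i x).1 (le_antisymm (hf i x).2 h1), ContinuousMap.sub_apply]
          exact sub_eq_zero.2 (congrFun (RT (restrictToPoints p g)) i).symm)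
    rw [map_sub, hyT, sub_eq_zero] at h0
    exact h0

/-- The images of the unit vectors under a linear isometry `ℓ_∞^ι → C(K)` satisfy
`∑ i, |T e_i| ≤ 1` pointwise. -/
lemma sum_abs_apply_single_le_one {ι K : Type*} [Fintype ι] [DecidableEq ι] [TopologicalSpace K]
    [CompactSpace K] (T : (ι → ℝ) →ₗᵢ[ℝ] C(K, ℝ)) (x : K) :
    ∑ i, |T (Pi.single i 1) x| ≤ 1 := by
  -- Choosing the signs at `x` turns the sum of moduli into a single value `T s x`.
  set s : ι → ℝ := fun i => (SignType.sign (T (Pi.single i 1) x) : ℝ) with hs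
  have hsn : ‖s‖ ≤ 1 := by
    refine (pi_norm_le_iff_of_nonneg zero_le_one).2 fun i => ?_
    rcases lt_trichotomy (T (Pi.single i 1) x) 0 with h | h | h <;> simp [hs, h]
  have hTs : T s x = ∑ i, |T (Pi.single i 1) x| := by
    conv_lhs => rw [pi_eq_sum_univ' s]
    rw [map_sum, ContinuousMap.sum_apply]
    refine Finset.sum_congr rfl fun i _ => ?_
    rw [map_smul, ContinuousMap.smul_apply, smul_eq_mul, hs, sign_mul_self]
  rw [← hTs]
  exact (le_abs_self _).trans (((T s).norm_coe_le_norm x).trans ((T.norm_map s).trans_le hsn))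

lemma exists_gDeltaPoints_of_uEmbeddable {ι K : Type*} [Fintype ι] [TopologicalSpace K]
    [CompactSpace K] [T2Space K] (h : UEmbeddable (ι → ℝ) C(K, ℝ)) :
    ∃ p : ι → K, Function.Injective p ∧ ∀ i, IsGδ ({p i} : Set K) := by
  classical
  obtain ⟨T, hT⟩ := h
  have norm_single (i : ι) : ‖(Pi.single i 1 : ι → ℝ)‖ = 1 := by
    rw [Pi.norm_single, norm_one]
  have off (i j : ι) (x : K) (hx : |T (Pi.single i 1) x| = 1) (hij : j ≠ i) :
      T (Pi.single j 1) x = 0 := by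
    have h1 := sum_abs_apply_single_le_one T x
    have h2 := Finset.sum_le_sum_of_subset_of_nonneg (Finset.subset_univ {i, j})
      fun k _ _ => abs_nonneg (T (Pi.single k 1) x)
    rw [Finset.sum_pair hij.symm, hx] at h2
    exact abs_nonpos_iff.1 (by linarith)
  have exists_peak (i : ι) : ∃ x, |T (Pi.single i 1) x| = 1 := by
    by_contra! hne
    have hlt : ‖T (Pi.single i 1)‖ < 1 :=
      (ContinuousMap.norm_lt_iff _ zero_lt_one).2 fun x =>
        lt_of_le_of_ne (((T _).norm_coe_le_norm x).trans_eq
          ((T.norm_map _).trans (norm_single i))) (hne x)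
    rw [T.norm_map, norm_single] at hlt
    exact lt_irrefl _ hlt
  let π (i : ι) : StrongDual ℝ (ι → ℝ) := ContinuousLinearMap.proj i
  have π_norm (i : ι) : ‖π i‖ = 1 := by
    refine le_antisymm ((π i).opNorm_le_bound zero_le_one fun a => ?_) ?_
    · rw [one_mul]
      exact norm_le_pi_norm a i
    · have := (π i).le_opNorm (Pi.single i 1)
      rw [norm_single, mul_one] at this
      simpa [π] using this
  -- At a peak point the factor is `±1`, the sign needed to map `T e_i` to one.
  let ev (i : ι) (x : K) : StrongDual ℝ C(K, ℝ) :=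
    T (Pi.single i 1) x • ContinuousMap.evalCLM ℝ x
  have ev_ext (i : ι) (x : K) (hx : |T (Pi.single i 1) x| = 1) :
      IsHahnBanachExtension T (π i) (ev i x) := by
    have hsq : T (Pi.single i 1) x * T (Pi.single i 1) x = 1 := by
      rw [← abs_mul_abs_self, hx, one_mul]
    have hcomp : (ev i x).comp T.toContinuousLinearMap = π i := by
      refine ContinuousLinearMap.coe_injective (LinearMap.pi_ext' fun j => ?_)
      ext
      change T (Pi.single i 1) x * T (Pi.single j 1) x = (Pi.single j 1 : ι → ℝ) i
      by_cases hij : j = i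
      · rw [hij, hsq, Pi.single_eq_same]
      · rw [off i j x hx hij, mul_zero, Pi.single_eq_of_ne (Ne.symm hij)]
    refine ⟨hcomp, le_antisymm ?_ ?_⟩
    · rw [π_norm]
      refine (ev i x).opNorm_le_bound zero_le_one fun g => ?_
      change ‖T (Pi.single i 1) x * g x‖ ≤ 1 * ‖g‖
      rw [norm_mul, Real.norm_eq_abs, hx, one_mul, one_mul]
      exact g.norm_coe_le_norm x
    · rw [← hcomp]
      refine ((ev i x).opNorm_comp_le _).trans ?_
      exact mul_le_of_le_one_right (norm_nonneg _) T.norm_toContinuousLinearMap_le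
  have peak_unique (i : ι) (x y : K) (hx : |T (Pi.single i 1) x| = 1)
      (hy : |T (Pi.single i 1) y| = 1) : x = y := by
    have hev := (hT (π i) (π_norm i)).unique (ev_ext i x hx) (ev_ext i y hy)
    have hev' (g : C(K, ℝ)) : T (Pi.single i 1) x * g x = T (Pi.single i 1) y * g y :=
      DFunLike.congr_fun hev g
    by_contra hxy
    obtain ⟨g, hg0, hg1, -⟩ := exists_continuous_zero_one_of_isClosed
      (isClosed_singleton (x := x)) (isClosed_singleton (x := y)) (by simpa using hxy)
    have h1 := hev' g
    rw [hg0 rfl, hg1 rfl, Pi.zero_apply, Pi.one_apply, mul_zero, mul_one] at h1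
    rw [← h1, abs_zero] at hy
    exact zero_ne_one hy
  choose p hp using exists_peak
  refine ⟨p, fun i j hij => ?_, fun i => ?_⟩
  · by_contra hne
    have h1 := hp j
    rw [← hij, off i j (p i) (hp i) (Ne.symm hne), abs_zero] at h1
    exact zero_ne_one h1
  · have hset : ({p i} : Set K) = (fun x => |T (Pi.single i 1) x|) ⁻¹' {1} := by
      ext x
      exact ⟨fun h => by rw [Set.mem_singleton_iff.1 h]; exact hp i,
        fun h => peak_unique i x (p i) h (hp i)⟩
    rw [hset]
    exact (IsGδ.singleton (1 : ℝ)).preimage (by fun_prop)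

theorem mainTheorem8 (N : ℕ) (K : Type*) [TopologicalSpace K] [CompactSpace K] [T2Space K] :
    UEmbeddable (Fin N → ℝ) C(K, ℝ) ↔ (N : ℕ∞) ≤ (gDeltaPoints K).encard := by
  constructor
  · intro h
    obtain ⟨p, hp, hG⟩ := exists_gDeltaPoints_of_uEmbeddable h
    have hsub : Set.range p ⊆ gDeltaPoints K := Set.range_subset_iff.2 hG
    refine le_trans (le_of_eq ?_) (Set.encard_le_encard hsub)
    rw [← Set.image_univ, hp.encard_image, Set.encard_univ, ENat.card_eq_coe_fintype_card,
      Fintype.card_fin]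
  · intro h
    obtain ⟨s, hs, hsN⟩ := Set.exists_subset_encard_eq h
    have hfin : s.Finite := Set.finite_of_encard_eq_coe hsN
    have := hfin.fintype
    have hcard : Fintype.card s = N := by
      rw [← Set.coe_fintypeCard] at hsN
      exact_mod_cast hsN
    let e := (Fintype.equivFinOfCardEq hcard).symm
    exact uEmbeddable_of_gDeltaPoints (fun i => (e i : K))
      (Subtype.val_injective.comp e.injective) fun i => hs (e i).2
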